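/- Consider finitely many photonic modes, with Hilbert space $\bigotimes_i \ell^2(\mathbb N_0)$ spanned by the number states $|n\rangle$. For $\gamma=(\gamma_i)_i\in\mathbb C^{\text{modes}}$ let $|\gamma\rangle=e^{-\sum_i|\gamma_i|^2/2}\sum_n\prod_i\frac{\gamma_i^{n_i}}{\sqrt{n_i!}}|n\rangle$ be the multimode coherent state. Call a unitary $U$ *passive linear optical* if it takes every multimode coherent state $|\alpha\rangle$ to a multimode coherent state $|\gamma\rangle$ with the same mean photon number, $\sum_i|\gamma_i|^2=\sum_i|\alpha_i|^2$. Let $U_1$ and $U_2$ be passive linear optical unitaries (the evolution from preparation to weak measurement, and from weak measurement to post-selection), and fix an input mode $a$, a weakly probed mode $b$ and a detected mode $c$ (not necessarily distinct). Let $\hat n_b$ be the photon number operator of mode $b$, let $E_m=|m\rangle\langle m|\otimes I$ be the effect of finding exactly $m$ photons in mode $c$ (so $E_0$ is "no click"), and let $E_\star=I-E_0$ ("click"). For an effect $E$ and an initial state $\psi$ with $U_1\psi\in\mathrm{dom}(\hat n_b)$ the (complex) weak value of $\hat n_b$ is $$ {}_{E}\langle n\rangle_{\psi}=\frac{\langle\psi|(U_2U_1)^\dagger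 E\,U_2\,\hat n_b\,U_1|\psi\rangle}{\langle\psi|(U_2U_1)^\dagger E\,U_2U_1|\psi\rangle}. $$ For $\alpha\in\mathbb C$ write $|\alpha,\vec 0\rangle$ for the coherent state $|\alpha\rangle$ in mode $a$ with all other modes in the vacuum, and $|1,\vec 0\rangle$ for one photon in mode $a$ with all other modes in the vacuum. Let $f(x)=x/\ln(1+x)$. **Theorem.** There is a number $T\in[0,1]$ (the transmittance) such that whenever $\alpha\in\mathbb C$ and $U_2U_1|\alpha,\vec 0\rangle=|\gamma\rangle$, one has $|\gamma_c|^2=T|\alpha|^2$. The click probability is $p_\star=p_\star(\alpha)=1-\exp(-T|\alpha|^2)$ for the input $|\alpha,\vec 0\rangle$, and $T$ for the input $|1,\vec 0\rangle$. If $T>0$ (a click is possible), then $U_1|1,\vec 0\rangle\in\mathrm{dom}(\hat n_b)$, the single-photon weak value post-selected on a click, ${}_{E_\star}\langle n\rangle_{|1,\vec0\rangle}$, equals ${}_{E_1}\langle n\rangle_{|1,\vec0\rangle}$, and for every $\alpha\in\mathbb C$ with $|\alpha|^2>0$ one has $U_1|\alpha,\vec 0\rangle\in\mathrm{dom}(\hat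 n_b)$ and $$ {}_{E_1}\langle n\rangle_{|1,\vec 0\rangle}=\Big[{}_{E_\star}\langle n\rangle_{|\alpha,\vec 0\rangle}-{}_{E_0}\langle n\rangle_{|\alpha,\vec 0\rangle}\Big]\,f(-p_\star),\qquad 0\le f(-p_\star)\le 1. $$ -/

import Mathlib

noncomputable section

namespace WeakValues

/-- The Hilbert space of finitely many bosonic (photonic) modes labelled by `ι`, in the
occupation-number representation: square-summable families of amplitudes indexed by the
occupation numbers `n : ι → ℕ`. This is the Hilbert-space tensor product over `ι` of the
single-mode space `ℓ²(ℕ)`. -/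
abbrev FockSpace (ι : Type*) : Type _ := lp (fun _ : ι → ℕ => ℂ) 2

variable {ι : Type*}

/-- A family dominated pointwise by a square-summable family is square-summable. -/
theorem memlp_two_of_le {κ : Type*} {x y : κ → ℂ} (hy : Memℓp y 2)
    (h : ∀ k, ‖x k‖ ≤ ‖y k‖) : Memℓp x 2 := by
  have h2 : (0 : ℝ) < (2 : ENNReal).toReal := by norm_num
  refine (memℓp_gen_iff h2).2 (((memℓp_gen_iff h2).1 hy).of_nonneg_of_le ?_ ?_)
  · intro k; positivity
  · intro k
    exact Real.rpow_le_rpow (norm_nonneg _) (h k) h2.le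

/-- The amplitude of the multimode coherent state with amplitudes `γ` on the number state `n`:
`exp (-(∑ᵢ |γᵢ|²) / 2) * ∏ᵢ γᵢ ^ nᵢ / √(nᵢ!)`. -/
def coherentAmplitude [Fintype ι] (γ : ι → ℂ) (n : ι → ℕ) : ℂ :=
  (Real.exp (-(∑ i, ‖γ i‖ ^ 2) / 2) : ℂ) *
    ∏ i, γ i ^ n i / (Real.sqrt ((n i).factorial : ℝ) : ℂ)

theorem memlp_coherentAmplitude [Fintype ι] (γ : ι → ℂ) :
    Memℓp (coherentAmplitude γ) 2 := by
  classical
  have h2 : (0 : ℝ) < (2 : ENNReal).toReal := by norm_num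
  refine (memℓp_gen_iff h2).2 ?_
  have key : ∀ n : ι → ℕ, ‖coherentAmplitude γ n‖ ^ (2 : ENNReal).toReal =
      Real.exp (-(∑ i, ‖γ i‖ ^ 2) / 2) ^ 2 *
        ∏ i, (‖γ i‖ ^ 2) ^ n i / ((n i).factorial : ℝ) := by
    intro n
    have e : (2 : ENNReal).toReal = ((2 : ℕ) : ℝ) := by norm_num
    rw [e, Real.rpow_natCast, coherentAmplitude, norm_mul, mul_pow, norm_prod,
      ← Finset.prod_pow, Complex.norm_real, Real.norm_eq_abs, sq_abs]
    congr 1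
    refine Finset.prod_congr rfl fun i _ => ?_
    rw [norm_div, norm_pow, div_pow, Complex.norm_real, Real.norm_eq_abs, sq_abs,
      Real.sq_sqrt (Nat.cast_nonneg _), ← pow_mul, ← pow_mul, mul_comm]
  simp_rw [key]
  refine Summable.mul_left _ ?_
  refine summable_of_sum_le (c := ∏ i, Real.exp (‖γ i‖ ^ 2)) (fun n => ?_) (fun s => ?_)
  · exact Finset.prod_nonneg fun i _ => by positivity
  · let N : ι → ℕ := fun i => s.sup (fun n => n i) + 1
    have hs : s ⊆ Fintype.piFinset (fun i => Finset.range (N i)) := by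
      intro n hn
      simp only [Fintype.mem_piFinset, Finset.mem_range, N]
      intro i
      exact Nat.lt_succ_of_le (Finset.le_sup (f := fun n : ι → ℕ => n i) hn)
    have h1 := Finset.sum_le_sum_of_subset_of_nonneg
      (f := fun n : ι → ℕ => ∏ i, (‖γ i‖ ^ 2) ^ n i / ((n i).factorial : ℝ)) hs
      fun n _ _ => Finset.prod_nonneg fun i _ => by positivity
    have h3 := Finset.prod_univ_sum (fun i => Finset.range (N i))
      (fun i k => (‖γ i‖ ^ 2) ^ k / (k.factorial : ℝ))
    refine h1.trans (h3.symm.le.trans ?_)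
    exact Finset.prod_le_prod (fun i _ => Finset.sum_nonneg fun k _ => by positivity)
      fun i _ => Real.sum_le_exp_of_nonneg (by positivity) _

/-- The multimode coherent state `|γ⟩ = ⨂ᵢ |γᵢ⟩`. -/
def coherentState [Fintype ι] (γ : ι → ℂ) : FockSpace ι :=
  ⟨coherentAmplitude γ, memlp_coherentAmplitude γ⟩

/-- The coherent state `|α⟩` in mode `a`, with all other modes in the vacuum. -/
def coherentInput [Fintype ι] [DecidableEq ι] (a : ι) (α : ℂ) : FockSpace ι :=
  coherentState (Pi.single a α)

/-- One photon in mode `a`, with all other modes in the vacuum. -/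
def singlePhoton [Fintype ι] [DecidableEq ι] (a : ι) : FockSpace ι :=
  lp.single 2 (Pi.single a 1 : ι → ℕ) (1 : ℂ)

/-- The photon number operator of mode `b` (the closed unbounded self-adjoint operator that
multiplies the amplitude on the number state `n` by `n b`), on its natural domain. -/
def numberOp (b : ι) : FockSpace ι →ₗ.[ℂ] FockSpace ι where
  domain :=
    { carrier := {ψ | Memℓp (fun n : ι → ℕ => (n b : ℂ) * ψ n) 2}
      add_mem' := by
        intro φ ψ hφ hψ
        have h := hφ.add hψ
        have e : (fun n : ι → ℕ => (n b : ℂ) * (φ + ψ : FockSpace ι) n) =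
            (fun n : ι → ℕ => (n b : ℂ) * φ n) + (fun n : ι → ℕ => (n b : ℂ) * ψ n) := by
          funext n
          simp [mul_add]
        simpa only [Set.mem_ofPred_eq, e] using h
      zero_mem' := by
        have e : (fun n : ι → ℕ => (n b : ℂ) * (0 : FockSpace ι) n) = 0 := by
          funext n
          simp
        simpa only [Set.mem_ofPred_eq, e] using zero_memℓp
      smul_mem' := by
        intro z ψ hψ
        have h := hψ.const_smul z
        have e : (fun n : ι → ℕ => (n b : ℂ) * (z • ψ : FockSpace ι) n) =
            z • (fun n : ι → ℕ => (n b : ℂ) * ψ n) := by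
          funext n
          simp [mul_left_comm]
        simpa only [Set.mem_ofPred_eq, e] using h }
  toFun :=
    { toFun := fun ψ => ⟨fun n => (n b : ℂ) * (ψ : FockSpace ι) n, ψ.2⟩
      map_add' := by
        intro φ ψ
        ext n
        exact mul_add _ _ _
      map_smul' := by
        intro z ψ
        ext n
        simp [mul_left_comm] }

/-- The effect `|m⟩⟨m| ⊗ I` of finding exactly `m` photons in mode `c`. -/
def photonCountEffect (c : ι) (m : ℕ) : FockSpace ι →L[ℂ] FockSpace ι :=
  LinearMap.mkContinuous
    { toFun := fun ψ => ⟨fun n => if n c = m then ψ n else 0,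
        memlp_two_of_le (lp.memℓp ψ) fun n => by split_ifs <;> simp⟩
      map_add' := by
        intro φ ψ
        ext n
        change (if n c = m then φ n + ψ n else 0) =
          (if n c = m then φ n else 0) + (if n c = m then ψ n else 0)
        split_ifs <;> simp
      map_smul' := by
        intro z ψ
        ext n
        by_cases h : n c = m <;> simp [h] }
    1 (by
      intro ψ
      rw [one_mul]
      refine lp.norm_mono two_ne_zero fun n => ?_
      by_cases h : n c = m <;> simp [h])

/-- The no-click effect of a click/no-click detector on mode `c`: no photon in mode `c`. -/
def noClickEffect (c : ι) : FockSpace ι →L[ℂ] FockSpace ι :=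
  photonCountEffect c 0

/-- The click effect of a click/no-click detector on mode `c`: `I - |0⟩⟨0| ⊗ I`. -/
def clickEffect (c : ι) : FockSpace ι →L[ℂ] FockSpace ι :=
  ContinuousLinearMap.id ℂ (FockSpace ι) - noClickEffect c

/-- A unitary is a passive linear-optical evolution if it takes every multimode coherent state
to a multimode coherent state with the same mean photon number. -/
def IsPassiveLinearOptical [Fintype ι] (U : FockSpace ι ≃ₗᵢ[ℂ] FockSpace ι) : Prop :=
  ∀ α : ι → ℂ, ∃ γ : ι → ℂ,
    U (coherentState α) = coherentState γ ∧ ∑ i, ‖γ i‖ ^ 2 = ∑ i, ‖α i‖ ^ 2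

/-- The probability `⟨ψ| U† E U |ψ⟩` of the measurement result with effect `E` after evolving
the (normalized) state `ψ` by `U = U₂ U₁`. -/
def resultProb {H : Type*} [NormedAddCommGroup H] [InnerProductSpace ℂ H]
    (E : H →L[ℂ] H) (U₁ U₂ : H ≃ₗᵢ[ℂ] H) (ψ : H) : ℝ :=
  (inner ℂ (U₂ (U₁ ψ)) (E (U₂ (U₁ ψ)))).re

/-- The (complex) weak value
`⟨ψ| (U₂ U₁)† E U₂ Λ U₁ |ψ⟩ / ⟨ψ| (U₂ U₁)† E (U₂ U₁) |ψ⟩` of `Λ`, for initial state `ψ`,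
evolution `U₁` up to the weak measurement and `U₂` after it, and post-selection on the
effect `E`. -/
def weakValue {H : Type*} [NormedAddCommGroup H] [InnerProductSpace ℂ H]
    (E : H →L[ℂ] H) (Λ : H →ₗ.[ℂ] H) (U₁ U₂ : H ≃ₗᵢ[ℂ] H) (ψ : H)
    (hψ : U₁ ψ ∈ Λ.domain) : ℂ :=
  inner ℂ (U₂ (U₁ ψ)) (E (U₂ (Λ ⟨U₁ ψ, hψ⟩))) / inner ℂ (U₂ (U₁ ψ)) (E (U₂ (U₁ ψ)))

/-- The scaling function `f(x) = x / ln (1 + x)`. -/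
def scaling (x : ℝ) : ℝ := x / Real.log (1 + x)

end WeakValues

end

noncomputable section

namespace WeakValues

open Filter Topology

/-! Up to normalization, coherent states are exponential vectors, whose inner products are `exp ⟪α,
β⟫`. A passive unitary therefore preserves the exponentials of inner products of amplitudes, and
their norms; this forces it to act on amplitudes by a unitary matrix
(`IsPassiveLinearOptical.exists_map_expState`). Differentiating exponential vectors at the vacuum,
the same matrix moves one-photon states (`map_onePhoton`).

Let `V₁`, `V₂` be the matrices, `u = V₁ e_a`, `v = V₂ u`, `w = V₂ e_b`. Then `T = |v_c|²`, and the
one-photon weak value is `conj v_c * w_c * u_b / T`. For coherent input, the no-click effect empties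
mode `c`, which lowers the weak value from `|β_b|²`, with `β = α u`, by `κ = |α|² * conj v_c * w_c *
u_b`. Since the click and no-click effects sum to the identity, click minus no-click is `κ / p` with
`p = 1 - exp (-T|α|²)` (`weakValue_click_sub_weakValue_noClick`). Finally `f(-p) = p / (T|α|²)`. -/

theorem eq_of_exp_ofReal_mul_eq {z w : ℂ}
    (h : ∀ t : ℝ, Complex.exp ((t : ℂ) * z) = Complex.exp ((t : ℂ) * w)) : z = w := by
  -- The complex exponential is not injective, but the derivative at `t = 0` recovers the exponent.
  have hd (x : ℂ) : HasDerivAt (fun t : ℝ => Complex.exp ((t : ℂ) * x)) x 0 := by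
    have h1 : HasDerivAt (fun t : ℂ => Complex.exp (t * x)) x ((0 : ℝ) : ℂ) := by
      simpa using ((hasDerivAt_id (((0 : ℝ) : ℂ))).mul_const x).cexp
    exact h1.comp_ofReal
  have hz := hd z
  simp_rw [h] at hz
  exact hz.unique (hd w)

/-! ### Maps preserving exponentials of inner products -/

section InnerPreserving

variable {E : Type*} [NormedAddCommGroup E] [InnerProductSpace ℂ E]

/-- A norm-preserving map that preserves inner products up to their exponentials preserves
inner products. -/
theorem inner_eq_of_exp_inner_eq {g : E → E} (hn : ∀ x, ‖g x‖ = ‖x‖)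
    (he : ∀ x y, Complex.exp (inner ℂ (g x) (g y)) = Complex.exp (inner ℂ x y)) (x y : E) :
    inner ℂ (g x) (g y) = inner ℂ x y := by
  -- The modulus of `exp z` fixes only the real part of `z`; the imaginary part is still unknown
  -- modulo `2π`.
  have hre (x y : E) : (inner ℂ (g x) (g y)).re = (inner ℂ x y).re := by
    have h := congrArg norm (he x y)
    rw [Complex.norm_exp, Complex.norm_exp] at h
    exact Real.exp_injective h
  -- Expanding `‖g (t x) - t g x‖²` involves only norms and the real part of an inner product. Real
  -- homogeneity then supplies the parameter `t` that removes the `2π` ambiguity.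
  have hsmul (t : ℝ) (x : E) : g ((t : ℂ) • x) = (t : ℂ) • g x := by
    rw [← sub_eq_zero, ← norm_eq_zero, ← sq_eq_zero_iff, @norm_sub_sq ℂ, inner_smul_right,
      RCLike.re_eq_complex_re, Complex.re_ofReal_mul, hre, norm_smul, hn, hn, norm_smul,
      inner_smul_left, Complex.conj_ofReal, Complex.re_ofReal_mul,
      ← RCLike.re_eq_complex_re, inner_self_eq_norm_sq, Complex.norm_real, mul_pow,
      Real.norm_eq_abs, sq_abs]
    ring
  refine eq_of_exp_ofReal_mul_eq fun t => ?_
  rw [← inner_smul_right, ← inner_smul_right, ← hsmul, he]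

/-- A map that preserves inner products is a linear isometry. -/
def linearIsometryOfInner (g : E → E) (h : ∀ x y, inner ℂ (g x) (g y) = inner ℂ x y) :
    E →ₗᵢ[ℂ] E :=
  LinearMap.isometryOfInner
    { toFun := g
      map_add' := fun x y => by
        rw [← sub_eq_zero, ← inner_self_eq_zero (𝕜 := ℂ)]
        simp only [inner_sub_left, inner_sub_right, inner_add_left, inner_add_right, h]
        ring
      map_smul' := fun z x => by
        rw [← sub_eq_zero, ← inner_self_eq_zero (𝕜 := ℂ)]
        simp only [inner_sub_left, inner_sub_right, inner_smul_left, inner_smul_right, h,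
          RingHom.id_apply]
        ring }
    h

end InnerPreserving

/-! ### Weak values depend only on the ray of the state -/

section WeakValue

variable {H : Type*} [NormedAddCommGroup H] [InnerProductSpace ℂ H]

theorem weakValue_eq (E : H →L[ℂ] H) (Λ : H →ₗ.[ℂ] H) (U₁ U₂ : H ≃ₗᵢ[ℂ] H) {ψ φ : H}
    (hφ : U₁ ψ = φ) (hψ : U₁ ψ ∈ Λ.domain) (h : φ ∈ Λ.domain) :
    weakValue E Λ U₁ U₂ ψ hψ =
      inner ℂ (U₂ φ) (E (U₂ (Λ ⟨φ, h⟩))) / inner ℂ (U₂ φ) (E (U₂ φ)) := by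
  subst hφ
  rfl

theorem weakValue_smul (E : H →L[ℂ] H) (Λ : H →ₗ.[ℂ] H) (U₁ U₂ : H ≃ₗᵢ[ℂ] H) {ψ φ : H} {k : ℂ}
    (hk : k ≠ 0) (hφ : φ = k • ψ) (hψ : U₁ ψ ∈ Λ.domain) (h : U₁ φ ∈ Λ.domain) :
    weakValue E Λ U₁ U₂ φ h = weakValue E Λ U₁ U₂ ψ hψ := by
  subst hφ
  rw [weakValue_eq E Λ U₁ U₂ (map_smul U₁ k ψ) h (Λ.domain.smul_mem k hψ)]
  have e : Λ ⟨k • U₁ ψ, Λ.domain.smul_mem k hψ⟩ = k • Λ ⟨U₁ ψ, hψ⟩ := Λ.map_smul k ⟨U₁ ψ, hψ⟩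
  have hk' : (starRingEnd ℂ) k ≠ 0 := by simpa using hk
  rw [e, weakValue]
  simp only [map_smul, inner_smul_left, inner_smul_right]
  rw [mul_div_mul_left _ _ hk, mul_div_mul_left _ _ hk']

end WeakValue

/-! ### Exponential vectors and the action of passive unitaries -/

variable {ι : Type*} [Fintype ι]

/-- Inner products of product vectors factor over the modes. -/
theorem inner_eq_prod (φ ψ : FockSpace ι) (g h : ι → ℕ → ℂ) (s : ι → ℂ)
    (hφ : ∀ n, φ n = ∏ i, g i (n i)) (hψ : ∀ n, ψ n = ∏ i, h i (n i))
    (hs : ∀ i, HasSum (fun k => (starRingEnd ℂ) (g i k) * h i k) (s i)) :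
    inner ℂ φ ψ = ∏ i, s i := by
  classical
  have h1 := lp.hasSum_inner (𝕜 := ℂ) φ ψ
  -- Boxes exhaust all occupation numbers, and the sum over a box is a product of single-mode
  -- partial sums.
  have hbox : Tendsto (fun N : ℕ => Fintype.piFinset (fun _ : ι => Finset.range N)) atTop atTop := by
    refine tendsto_atTop_finset_of_monotone ?_ ?_
    · intro N M hNM n hn
      simp only [Fintype.mem_piFinset, Finset.mem_range] at hn ⊢
      exact fun i => (hn i).trans_le hNM
    · intro n
      refine ⟨Finset.univ.sup n + 1, ?_⟩
      simp only [Fintype.mem_piFinset, Finset.mem_range]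
      exact fun i => Nat.lt_succ_of_le (Finset.le_sup (Finset.mem_univ i))
  refine tendsto_nhds_unique (h1.comp hbox) ?_
  have h2 : Tendsto (fun N : ℕ => ∏ i, ∑ k ∈ Finset.range N, (starRingEnd ℂ) (g i k) * h i k)
      atTop (𝓝 (∏ i, s i)) :=
    tendsto_finsetProd _ fun i _ => (hs i).tendsto_sum_nat
  refine h2.congr fun N => ?_
  rw [Finset.prod_univ_sum]
  refine Finset.sum_congr rfl fun n _ => ?_
  change _ = ψ n * (starRingEnd ℂ) (φ n)
  rw [hφ, hψ, map_prod, ← Finset.prod_mul_distrib]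
  exact Finset.prod_congr rfl fun i _ => mul_comm _ _

theorem conj_sqrt_factorial_mul_self (k : ℕ) :
    (starRingEnd ℂ) (Real.sqrt (k.factorial : ℝ) : ℂ) * (Real.sqrt (k.factorial : ℝ) : ℂ)
      = (k.factorial : ℂ) := by
  rw [Complex.conj_ofReal, ← Complex.ofReal_mul, Real.mul_self_sqrt (Nat.cast_nonneg _)]
  simp

theorem hasSum_pow_div_factorial (x y : ℂ) :
    HasSum (fun k : ℕ => (starRingEnd ℂ) (x ^ k / (Real.sqrt (k.factorial : ℝ) : ℂ)) *
      (y ^ k / (Real.sqrt (k.factorial : ℝ) : ℂ))) (Complex.exp ((starRingEnd ℂ) x * y)) := by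
  have h := NormedSpace.expSeries_div_hasSum_exp ((starRingEnd ℂ) x * y)
  rw [← Complex.exp_eq_exp_ℂ] at h
  refine h.congr_fun fun k => ?_
  rw [map_div₀, div_mul_div_comm, conj_sqrt_factorial_mul_self, map_pow, mul_pow]

theorem hasSum_natCast_mul_pow_div_factorial (x y : ℂ) :
    HasSum (fun k : ℕ => (starRingEnd ℂ) (x ^ k / (Real.sqrt (k.factorial : ℝ) : ℂ)) *
      ((k : ℂ) * (y ^ k / (Real.sqrt (k.factorial : ℝ) : ℂ))))
      ((starRingEnd ℂ) x * y * Complex.exp ((starRingEnd ℂ) x * y)) := by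
  have h := NormedSpace.expSeries_div_hasSum_exp ((starRingEnd ℂ) x * y)
  rw [← Complex.exp_eq_exp_ℂ] at h
  have h := h.mul_left ((starRingEnd ℂ) x * y)
  -- The `k = 0` term vanishes; in the others `k` cancels against `k!`, leaving the shifted
  -- exponential series.
  rw [← hasSum_nat_add_iff' 1]
  simp only [Finset.sum_range_one, Nat.cast_zero, zero_mul, mul_zero, sub_zero]
  refine h.congr_fun fun k => ?_
  have hk : ((k : ℂ) + 1) ≠ 0 := by exact_mod_cast k.succ_ne_zero
  have hf : (k.factorial : ℂ) ≠ 0 := by exact_mod_cast k.factorial_ne_zero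
  rw [mul_left_comm, map_div₀, div_mul_div_comm, conj_sqrt_factorial_mul_self, map_pow, ← mul_pow,
    Nat.factorial_succ]
  push_cast
  field_simp
  rw [pow_succ']

/-- The unnormalized coherent state (exponential vector) with amplitudes `γ`. -/
def expState (γ : EuclideanSpace ℂ ι) : FockSpace ι :=
  (Real.exp ((∑ i, ‖γ i‖ ^ 2) / 2) : ℂ) • coherentState γ.ofLp

theorem expState_apply (γ : EuclideanSpace ℂ ι) (n : ι → ℕ) :
    expState γ n = ∏ i, γ i ^ n i / (Real.sqrt ((n i).factorial : ℝ) : ℂ) := by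
  change (Real.exp ((∑ i, ‖γ i‖ ^ 2) / 2) : ℂ) * coherentAmplitude γ.ofLp n = _
  rw [coherentAmplitude, ← mul_assoc, ← Complex.ofReal_mul, ← Real.exp_add]
  simp [neg_div]

theorem coherentState_eq_smul_expState (γ : EuclideanSpace ℂ ι) :
    coherentState γ.ofLp = (Real.exp (-‖γ‖ ^ 2 / 2) : ℂ) • expState γ := by
  rw [expState, smul_smul, ← Complex.ofReal_mul, ← Real.exp_add, EuclideanSpace.norm_sq_eq]
  simp [neg_div]

theorem inner_euclidean_eq_sum (α β : EuclideanSpace ℂ ι) :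
    inner ℂ α β = ∑ i, (starRingEnd ℂ) (α i) * β i := by
  rw [PiLp.inner_apply]
  exact Finset.sum_congr rfl fun i _ => by rw [RCLike.inner_apply, mul_comm]

theorem inner_expState (α β : EuclideanSpace ℂ ι) :
    inner ℂ (expState α) (expState β) = Complex.exp (inner ℂ α β) := by
  rw [inner_eq_prod _ _ _ _ _ (expState_apply α) (expState_apply β)
    fun i => hasSum_pow_div_factorial (α i) (β i), ← Complex.exp_sum, inner_euclidean_eq_sum]

/-- Since `k ≤ 2 ^ k`, the weighted amplitudes are dominated by the exponential vector with its
amplitude in mode `b` doubled. -/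
theorem expState_mem_numberOp_domain (b : ι) (γ : EuclideanSpace ℂ ι) :
    expState γ ∈ (numberOp b).domain := by
  classical
  change Memℓp (fun n : ι → ℕ => (n b : ℂ) * expState γ n) 2
  refine memlp_two_of_le (lp.memℓp (expState (WithLp.toLp 2
    (fun i => (if i = b then 2 else 1) * γ i) : EuclideanSpace ℂ ι))) fun n => ?_
  rw [expState_apply, expState_apply]
  simp only [mul_pow, mul_div_assoc, Finset.prod_mul_distrib, ite_pow, one_pow, Finset.prod_ite_eq',
    Finset.mem_univ, if_true]
  rw [norm_mul, norm_mul]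
  refine mul_le_mul_of_nonneg_right ?_ (norm_nonneg _)
  rw [Complex.norm_natCast, norm_pow, Complex.norm_ofNat]
  exact_mod_cast (Nat.lt_two_pow_self).le

theorem inner_expState_numberOp (b : ι) (α β : EuclideanSpace ℂ ι)
    (h : expState β ∈ (numberOp b).domain) :
    inner ℂ (expState α) (numberOp b ⟨expState β, h⟩) =
      (starRingEnd ℂ) (α b) * β b * Complex.exp (inner ℂ α β) := by
  classical
  rw [inner_eq_prod _ _ (fun i k => α i ^ k / (Real.sqrt (k.factorial : ℝ) : ℂ))
    (fun i k => (if i = b then (k : ℂ) else 1) *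
      (β i ^ k / (Real.sqrt (k.factorial : ℝ) : ℂ)))
    (fun i => (if i = b then (starRingEnd ℂ) (α b) * β b else 1) *
      Complex.exp ((starRingEnd ℂ) (α i) * β i)) (expState_apply α) ?_ ?_]
  · rw [Finset.prod_mul_distrib, ← Complex.exp_sum, inner_euclidean_eq_sum]
    simp
  · intro n
    change (n b : ℂ) * expState β n = _
    rw [expState_apply, Finset.prod_mul_distrib]
    simp
  · intro i
    by_cases hi : i = b
    · subst hi
      simpa using hasSum_natCast_mul_pow_div_factorial (α i) (β i)
    · simpa [hi] using hasSum_pow_div_factorial (α i) (β i)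

/-- A passive linear-optical unitary acts on coherent amplitudes by a unitary matrix. -/
theorem IsPassiveLinearOptical.exists_map_expState {U : FockSpace ι ≃ₗᵢ[ℂ] FockSpace ι}
    (hU : IsPassiveLinearOptical U) :
    ∃ V : EuclideanSpace ℂ ι ≃ₗᵢ[ℂ] EuclideanSpace ℂ ι,
      ∀ α, U (expState α) = expState (V α) := by
  choose g hg hgn using hU
  let G : EuclideanSpace ℂ ι → EuclideanSpace ℂ ι := fun α => WithLp.toLp 2 (g α.ofLp)
  have hn (α) : ‖G α‖ = ‖α‖ := by
    rw [← sq_eq_sq₀ (norm_nonneg _) (norm_nonneg _), EuclideanSpace.norm_sq_eq,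
      EuclideanSpace.norm_sq_eq]
    exact hgn α.ofLp
  have hG (α) : U (expState α) = expState (G α) := by
    -- Equal mean photon numbers make the two normalization factors agree.
    rw [expState, expState, map_smul, hg, ← hgn]
  have hi := inner_eq_of_exp_inner_eq hn fun α β => by
    rw [← inner_expState, ← inner_expState, ← hG, ← hG, U.inner_map_map]
  -- An isometry between spaces of equal finite dimension is onto.
  exact ⟨(linearIsometryOfInner G hi).toLinearIsometryEquiv rfl, hG⟩

/-! ### One-photon states as derivatives of exponential vectors -/

variable [DecidableEq ι]

/-- The one-photon state with wave function `α`. -/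
def onePhoton (α : EuclideanSpace ℂ ι) : FockSpace ι :=
  ∑ i, α i • singlePhoton i

theorem singlePhoton_apply (i : ι) (n : ι → ℕ) :
    (singlePhoton i : FockSpace ι) n = if n = Pi.single i 1 then 1 else 0 := by
  rw [singlePhoton, lp.single_apply]
  by_cases h : n = Pi.single i 1
  · subst h; simp
  · simp [h]

theorem inner_singlePhoton_left (i : ι) (φ : FockSpace ι) :
    inner ℂ (singlePhoton i) φ = φ (Pi.single i 1) := by
  rw [singlePhoton, lp.inner_single_left]
  simp

theorem inner_singlePhoton_singlePhoton (i j : ι) :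
    inner ℂ (singlePhoton i : FockSpace ι) (singlePhoton j) = if i = j then 1 else 0 := by
  rw [inner_singlePhoton_left, singlePhoton_apply]
  by_cases h : i = j
  · simp [h]
  · rw [if_neg h, if_neg fun h' => by simpa [h] using congrFun h' i]

theorem inner_singlePhoton_onePhoton (i : ι) (α : EuclideanSpace ℂ ι) :
    inner ℂ (singlePhoton i) (onePhoton α) = α i := by
  simp [onePhoton, inner_singlePhoton_singlePhoton]

theorem inner_onePhoton_left (α : EuclideanSpace ℂ ι) (φ : FockSpace ι) :
    inner ℂ (onePhoton α) φ = ∑ i, (starRingEnd ℂ) (α i) * inner ℂ (singlePhoton i) φ := by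
  simp [onePhoton, mul_comm]

theorem expState_single (i : ι) (α : EuclideanSpace ℂ ι) :
    expState α (Pi.single i 1) = α i := by
  rw [expState_apply, Finset.prod_eq_single i]
  · simp
  · intro j _ hj
    simp [hj]
  · simp

/-- Removing the orthogonal vacuum and one-photon components leaves the tail of the exponential
series. -/
theorem norm_expState_sub_sq (α : EuclideanSpace ℂ ι) :
    ‖expState α - expState 0 - onePhoton α‖ ^ 2 = Real.exp (‖α‖ ^ 2) - 1 - ‖α‖ ^ 2 := by
  have h01 : inner ℂ (onePhoton α) (expState 0 : FockSpace ι) = 0 := by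
    simp [inner_onePhoton_left, inner_singlePhoton_left, expState_single]
  have h1 : inner ℂ (onePhoton α) (expState α) = inner ℂ α α := by
    simp only [inner_onePhoton_left, inner_singlePhoton_left, expState_single,
      inner_euclidean_eq_sum]
  have h11 : inner ℂ (onePhoton α) (onePhoton α) = inner ℂ α α := by
    simp only [inner_onePhoton_left, inner_singlePhoton_onePhoton, inner_euclidean_eq_sum]
  have h10 : inner ℂ (expState 0 : FockSpace ι) (onePhoton α) = 0 := by
    rw [← inner_conj_symm, h01, map_zero]
  have h1' : inner ℂ (expState α) (onePhoton α) = inner ℂ α α := by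
    rw [← inner_conj_symm, h1, inner_conj_symm]
  have key : inner ℂ (expState α - expState 0 - onePhoton α)
      (expState α - expState 0 - onePhoton α) = Complex.exp (inner ℂ α α) - 1 - inner ℂ α α := by
    simp only [inner_sub_left, inner_sub_right, inner_expState, h01, h1, h11, h10, h1',
      inner_zero_left, inner_zero_right, Complex.exp_zero]
    ring
  rw [inner_self_eq_norm_sq_to_K, inner_self_eq_norm_sq_to_K] at key
  have key' := congrArg Complex.re key
  simpa [← Complex.ofReal_pow, ← Complex.ofReal_exp] using key'

theorem hasDerivAt_expState_smul (α : EuclideanSpace ℂ ι) :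
    HasDerivAt (fun t : ℝ => expState ((t : ℂ) • α)) (onePhoton α) 0 := by
  have hone (t : ℝ) : onePhoton ((t : ℂ) • α) = t • onePhoton α := by
    simp only [onePhoton, Finset.smul_sum, PiLp.smul_apply, Complex.coe_smul, smul_assoc]
  rw [hasDerivAt_iff_isLittleO]
  have hO : (fun t : ℝ => expState ((t : ℂ) • α) - expState (((0 : ℝ) : ℂ) • α)
      - (t - 0) • onePhoton α) =O[𝓝 0] fun t : ℝ => t ^ 2 := by
    refine Asymptotics.IsBigO.of_bound (‖α‖ ^ 2) ?_
    have hc : Tendsto (fun t : ℝ => t ^ 2 * ‖α‖ ^ 2) (𝓝 0) (𝓝 0) := by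
      have : Continuous fun t : ℝ => t ^ 2 * ‖α‖ ^ 2 := by fun_prop
      simpa using this.tendsto 0
    filter_upwards [hc.eventually (gt_mem_nhds one_pos)] with t ht
    have h := norm_expState_sub_sq ((t : ℂ) • α)
    rw [hone, norm_smul, Complex.norm_real, mul_pow, Real.norm_eq_abs, sq_abs] at h
    have hx : (0 : ℝ) ≤ t ^ 2 * ‖α‖ ^ 2 := by positivity
    -- The squared remainder is at most `x²`, so its norm is at most `x = t²‖α‖²`, which is `o(t)`.
    have h2 := Real.abs_exp_sub_one_sub_id_le (x := t ^ 2 * ‖α‖ ^ 2)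
      (by rw [abs_of_nonneg hx]; exact ht.le)
    rw [← h, abs_of_nonneg (by positivity)] at h2
    have h3 := abs_le_of_sq_le_sq h2 hx
    simp only [Complex.ofReal_zero, zero_smul, sub_zero, norm_pow, Real.norm_eq_abs, sq_abs]
    rw [mul_comm]
    exact (le_abs_self _).trans h3
  refine hO.trans_isLittleO ?_
  simpa using Asymptotics.isLittleO_pow_pow (𝕜 := ℝ) (m := 1) (n := 2) one_lt_two

/-- A bounded linear map commutes with the derivative at the vacuum, and derivatives are unique. -/
theorem map_onePhoton {U : FockSpace ι ≃ₗᵢ[ℂ] FockSpace ι}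
    {V : EuclideanSpace ℂ ι ≃ₗᵢ[ℂ] EuclideanSpace ℂ ι}
    (h : ∀ α, U (expState α) = expState (V α)) (α : EuclideanSpace ℂ ι) :
    U (onePhoton α) = onePhoton (V α) := by
  have h1 := (U.toContinuousLinearEquiv.toContinuousLinearMap.restrictScalars ℝ).hasFDerivAt
    |>.comp_hasDerivAt 0 (hasDerivAt_expState_smul α)
  refine h1.unique ((hasDerivAt_expState_smul (V α)).congr_of_eventuallyEq
    (Eventually.of_forall fun t => ?_))
  change U (expState ((t : ℂ) • α)) = _
  rw [h, map_smul]

theorem onePhoton_single (a : ι) : onePhoton (EuclideanSpace.single a 1) = singlePhoton a := by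
  rw [onePhoton, Finset.sum_eq_single a] <;> simp +contextual

theorem coherentInput_eq (a : ι) (α : ℂ) :
    coherentInput a α = (Real.exp (-‖α‖ ^ 2 / 2) : ℂ) • expState (α • EuclideanSpace.single a 1) := by
  have h := coherentState_eq_smul_expState (α • EuclideanSpace.single a (1 : ℂ))
  rw [norm_smul, PiLp.norm_single, norm_one, mul_one] at h
  rw [← h, coherentInput]
  congr 1
  ext i
  simp [Pi.single_apply]

omit [DecidableEq ι] in
theorem coherentAmplitude_zero (γ : ι → ℂ) :
    coherentAmplitude γ 0 = (Real.exp (-(∑ i, ‖γ i‖ ^ 2) / 2) : ℂ) := by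
  simp [coherentAmplitude]

theorem coherentAmplitude_single (γ : ι → ℂ) (i : ι) :
    coherentAmplitude γ (Pi.single i 1) = coherentAmplitude γ 0 * γ i := by
  rw [coherentAmplitude_zero, coherentAmplitude, Finset.prod_eq_single i]
  · simp
  · intro j _ hj
    simp [hj]
  · simp

/-- The ratio of the one-photon amplitude in mode `i` to the vacuum amplitude is `γ i`. -/
theorem coherentState_injective :
    Function.Injective (coherentState : (ι → ℂ) → FockSpace ι) := by
  intro γ δ h
  have hn (n : ι → ℕ) : coherentAmplitude γ n = coherentAmplitude δ n :=
    congrArg (fun φ : FockSpace ι => φ n) h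
  ext i
  have h1 := hn (Pi.single i 1)
  rw [coherentAmplitude_single, coherentAmplitude_single, hn 0] at h1
  refine mul_left_cancel₀ ?_ h1
  rw [coherentAmplitude_zero]
  exact_mod_cast (Real.exp_pos _).ne'

/-! ### Detection effects -/

omit [Fintype ι] [DecidableEq ι] in
theorem photonCountEffect_apply (c : ι) (m : ℕ) (φ : FockSpace ι) (n : ι → ℕ) :
    photonCountEffect c m φ n = if n c = m then φ n else 0 := rfl

theorem photonCountEffect_one_singlePhoton (c i : ι) :
    photonCountEffect c 1 (singlePhoton i) = if i = c then singlePhoton i else 0 := by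
  ext n
  rw [photonCountEffect_apply, singlePhoton_apply]
  by_cases h : i = c
  · subst h
    rw [if_pos rfl, singlePhoton_apply]
    by_cases hn : n = Pi.single i 1 <;> simp [hn]
  · rw [if_neg h]
    by_cases hn : n = Pi.single i 1
    · subst hn
      simp [Ne.symm h]
    · simp [hn]

theorem clickEffect_singlePhoton (c i : ι) :
    clickEffect c (singlePhoton i) = if i = c then singlePhoton i else 0 := by
  change singlePhoton i - photonCountEffect c 0 (singlePhoton i) = _
  ext n
  change singlePhoton i n - photonCountEffect c 0 (singlePhoton i) n = _
  rw [photonCountEffect_apply, singlePhoton_apply]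
  by_cases h : i = c
  · subst h
    rw [if_pos rfl, singlePhoton_apply]
    by_cases hn : n = Pi.single i 1 <;> simp [hn]
  · rw [if_neg h]
    by_cases hn : n = Pi.single i 1
    · subst hn
      simp [Ne.symm h]
    · simp [hn]

theorem photonCountEffect_one_onePhoton (c : ι) (α : EuclideanSpace ℂ ι) :
    photonCountEffect c 1 (onePhoton α) = α c • singlePhoton c := by
  simp [onePhoton, photonCountEffect_one_singlePhoton]

/-- With a single photon present, a click means exactly one photon, so the result agrees with
`photonCountEffect_one_onePhoton`. -/
theorem clickEffect_onePhoton (c : ι) (α : EuclideanSpace ℂ ι) :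
    clickEffect c (onePhoton α) = α c • singlePhoton c := by
  simp [onePhoton, clickEffect_singlePhoton]

theorem inner_onePhoton_singlePhoton (c : ι) (α : EuclideanSpace ℂ ι) :
    inner ℂ (onePhoton α) (singlePhoton c) = (starRingEnd ℂ) (α c) := by
  rw [← inner_conj_symm, inner_singlePhoton_onePhoton]

/-- The amplitudes with mode `c` emptied. -/
def emptyMode (c : ι) (γ : EuclideanSpace ℂ ι) : EuclideanSpace ℂ ι :=
  γ - γ c • EuclideanSpace.single c 1

omit [Fintype ι] in
theorem emptyMode_apply (c : ι) (γ : EuclideanSpace ℂ ι) (i : ι) :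
    emptyMode c γ i = if i = c then 0 else γ i := by
  by_cases h : i = c
  · subst h; simp [emptyMode]
  · simp [emptyMode, h]

/-- Setting the amplitude of mode `c` to zero turns its factor into `0 ^ n c`, which is the
projection onto `n c = 0` because `0 ^ 0 = 1`. -/
theorem noClickEffect_expState (c : ι) (γ : EuclideanSpace ℂ ι) :
    noClickEffect c (expState γ) = expState (emptyMode c γ) := by
  ext n
  change (if n c = 0 then expState γ n else 0) = _
  rw [expState_apply, expState_apply]
  split_ifs with h
  · refine Finset.prod_congr rfl fun i _ => ?_
    rw [emptyMode_apply]
    by_cases hi : i = c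
    · subst hi; simp [h]
    · rw [if_neg hi]
  · rw [Finset.prod_eq_zero (Finset.mem_univ c)]
    simp [emptyMode_apply, h]

omit [Fintype ι] [DecidableEq ι] in
theorem inner_noClickEffect_right (c : ι) (φ ψ : FockSpace ι) :
    inner ℂ φ (noClickEffect c ψ) = inner ℂ (noClickEffect c φ) ψ := by
  rw [lp.inner_eq_tsum, lp.inner_eq_tsum]
  refine tsum_congr fun n => ?_
  change inner ℂ (φ n) (if n c = 0 then ψ n else 0) = inner ℂ (if n c = 0 then φ n else 0) (ψ n)
  split_ifs <;> simp

omit [Fintype ι] [DecidableEq ι] in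
theorem inner_clickEffect_right (c : ι) (φ ψ : FockSpace ι) :
    inner ℂ φ (clickEffect c ψ) = inner ℂ φ ψ - inner ℂ (noClickEffect c φ) ψ := by
  rw [← inner_noClickEffect_right, ← inner_sub_right]
  rfl

/-! ### The photon number of one-photon states -/

theorem singlePhoton_mem_numberOp_domain (b i : ι) :
    (singlePhoton i : FockSpace ι) ∈ (numberOp b).domain := by
  change Memℓp (fun n : ι → ℕ => (n b : ℂ) * singlePhoton i n) 2
  refine memlp_two_of_le (lp.memℓp (singlePhoton i : FockSpace ι)) fun n => ?_
  rw [singlePhoton_apply]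
  by_cases h : n = Pi.single i 1
  · subst h
    by_cases hb : b = i <;> simp [hb]
  · simp [h]

theorem onePhoton_mem_numberOp_domain (b : ι) (α : EuclideanSpace ℂ ι) :
    onePhoton α ∈ (numberOp b).domain :=
  Submodule.sum_mem _ fun i _ => Submodule.smul_mem _ _ (singlePhoton_mem_numberOp_domain b i)

theorem onePhoton_apply (α : EuclideanSpace ℂ ι) (n : ι → ℕ) :
    onePhoton α n = ∑ i, α i * if n = Pi.single i 1 then 1 else 0 := by
  rw [onePhoton, lp.coeFn_sum, Finset.sum_apply]
  exact Finset.sum_congr rfl fun i _ => congrArg (α i * ·) (singlePhoton_apply i n)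

theorem numberOp_onePhoton (b : ι) (α : EuclideanSpace ℂ ι)
    (h : onePhoton α ∈ (numberOp b).domain) :
    numberOp b ⟨onePhoton α, h⟩ = α b • singlePhoton b := by
  ext n
  change (n b : ℂ) * onePhoton α n = α b * singlePhoton b n
  rw [onePhoton_apply, singlePhoton_apply, Finset.mul_sum, Finset.sum_eq_single b]
  · by_cases hn : n = Pi.single b 1 <;> simp [hn]
  · intro i _ hi
    by_cases hn : n = Pi.single i 1 <;> simp [hn, Ne.symm hi]
  · simp

theorem inner_emptyMode_left (c : ι) (γ : EuclideanSpace ℂ ι) :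
    inner ℂ (emptyMode c γ) γ = ((‖γ‖ ^ 2 - ‖γ c‖ ^ 2 : ℝ) : ℂ) := by
  rw [emptyMode, inner_sub_left, inner_smul_left, EuclideanSpace.inner_single_left,
    inner_self_eq_norm_sq_to_K, map_one, one_mul, Complex.conj_mul']
  push_cast
  rfl

/-- The click and no-click weak values of the photon number differ, for a coherent state, by the
unnormalized one-photon weak value over the click probability. -/
theorem weakValue_click_sub_weakValue_noClick (b c : ι) {U₁ U₂ : FockSpace ι ≃ₗᵢ[ℂ] FockSpace ι}
    {V : EuclideanSpace ℂ ι ≃ₗᵢ[ℂ] EuclideanSpace ℂ ι}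
    (hV : ∀ α, U₂ (expState α) = expState (V α)) {ψ : FockSpace ι} {β : EuclideanSpace ℂ ι}
    (hψ : U₁ ψ = expState β) (h : U₁ ψ ∈ (numberOp b).domain) (hc : V β c ≠ 0) :
    weakValue (clickEffect c) (numberOp b) U₁ U₂ ψ h -
        weakValue (noClickEffect c) (numberOp b) U₁ U₂ ψ h =
      (starRingEnd ℂ) (V β c) * V (EuclideanSpace.single b 1) c * β b /
        ((1 - Real.exp (-‖V β c‖ ^ 2) : ℝ) : ℂ) := by
  have hβ := expState_mem_numberOp_domain b β
  rw [weakValue_eq _ _ _ _ hψ h hβ, weakValue_eq _ _ _ _ hψ h hβ]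
  simp only [inner_clickEffect_right, inner_noClickEffect_right, U₂.inner_map_map]
  rw [hV, noClickEffect_expState]
  -- With the effect moved to the left, the no-click bra is the exponential vector of `y`, which
  -- `U₂` pulls back to amplitudes `V.symm y`.
  set y := emptyMode c (V β) with hy
  have hUy : expState y = U₂ (expState (V.symm y)) := by rw [hV, V.apply_symm_apply]
  have hin : inner ℂ (V.symm y) β = inner ℂ y (V β) := by
    rw [← V.inner_map_map, V.apply_symm_apply]
  have hb : (starRingEnd ℂ) (V.symm y b) =
      (starRingEnd ℂ) (β b) - (starRingEnd ℂ) (V β c) * V (EuclideanSpace.single b 1) c := by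
    have h1 : V.symm (EuclideanSpace.single c 1) b =
        (starRingEnd ℂ) (V (EuclideanSpace.single b 1) c) := by
      have h2 := V.inner_map_map (EuclideanSpace.single b 1) (V.symm (EuclideanSpace.single c 1))
      rw [V.apply_symm_apply, EuclideanSpace.inner_single_right,
        EuclideanSpace.inner_single_left] at h2
      simpa using h2.symm
    rw [hy, emptyMode, map_sub, map_smul, V.symm_apply_apply, PiLp.sub_apply, PiLp.smul_apply, h1]
    simp
  have hnum : inner ℂ (expState y) (U₂ (numberOp b ⟨expState β, hβ⟩)) =
      (starRingEnd ℂ) (V.symm y b) * β b * Complex.exp (inner ℂ y (V β)) := by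
    rw [hUy, U₂.inner_map_map, inner_expState_numberOp, hin]
  rw [hnum, inner_expState_numberOp, inner_expState, inner_expState, hy, inner_emptyMode_left, ← hy,
    hb, inner_self_eq_norm_sq_to_K, V.norm_map]
  have hexp : Complex.exp ((‖β‖ ^ 2 - ‖V β c‖ ^ 2 : ℝ) : ℂ) =
      Complex.exp ((‖β‖ : ℂ) ^ 2) * (Real.exp (-‖V β c‖ ^ 2) : ℂ) := by
    rw [Complex.ofReal_exp, ← Complex.exp_add]
    push_cast
    ring_nf
  have hr : (1 : ℂ) - (Real.exp (-‖V β c‖ ^ 2) : ℂ) ≠ 0 := by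
    have h3 : Real.exp (-‖V β c‖ ^ 2) < 1 := by
      rw [Real.exp_lt_one_iff, neg_lt_zero]
      exact pow_pos (norm_pos_iff.2 hc) 2
    exact_mod_cast (sub_pos.2 h3).ne'
  have hr0 : (Real.exp (-‖V β c‖ ^ 2) : ℂ) ≠ 0 := by exact_mod_cast (Real.exp_pos _).ne'
  have hq := Complex.exp_ne_zero ((‖β‖ : ℂ) ^ 2)
  have hK : ((‖β‖ : ℝ) : ℂ) = RCLike.ofReal ‖β‖ := rfl
  rw [hexp, ← hK, Complex.ofReal_sub, Complex.ofReal_one]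
  -- With `X = |β_b|²`, `r` the no-click probability and `κ` the shift, what remains is `(X - r(X -
  -- κ))/(1 - r) - (X - κ) = κ/(1 - r)`.
  generalize Complex.exp ((‖β‖ : ℂ) ^ 2) = q at *
  generalize (Real.exp (-‖V β c‖ ^ 2) : ℂ) = r at *
  have hd : q - q * r = q * (1 - r) := by ring
  rw [hd]
  field_simp
  ring

end WeakValues

end

/-! ### The weak value relation -/

theorem mainTheorem1 {ι : Type*} [Fintype ι] [DecidableEq ι] (a b c : ι)
    (U₁ U₂ : WeakValues.FockSpace ι ≃ₗᵢ[ℂ] WeakValues.FockSpace ι)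
    (hU₁ : WeakValues.IsPassiveLinearOptical U₁)
    (hU₂ : WeakValues.IsPassiveLinearOptical U₂) :
    ∃ T : ℝ, 0 ≤ T ∧ T ≤ 1 ∧
      -- `T` is the transmittance from the input mode `a` to the detected mode `c`
      (∀ (α : ℂ) (γ : ι → ℂ),
        U₂ (U₁ (WeakValues.coherentInput a α)) = WeakValues.coherentState γ →
          ‖γ c‖ ^ 2 = T * ‖α‖ ^ 2) ∧
      -- the click probabilities for coherent and for single-photon input
      (∀ α : ℂ, WeakValues.resultProb (WeakValues.clickEffect c) U₁ U₂
          (WeakValues.coherentInput a α) = 1 - Real.exp (-(T * ‖α‖ ^ 2))) ∧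
      WeakValues.resultProb (WeakValues.clickEffect c) U₁ U₂ (WeakValues.singlePhoton a) = T ∧
      -- the relation between the weak values, whenever a click is possible
      (0 < T →
        ∃ h₁ : U₁ (WeakValues.singlePhoton a) ∈ (WeakValues.numberOp b).domain,
          WeakValues.weakValue (WeakValues.clickEffect c) (WeakValues.numberOp b) U₁ U₂
              (WeakValues.singlePhoton a) h₁ =
            WeakValues.weakValue (WeakValues.photonCountEffect c 1) (WeakValues.numberOp b) U₁ U₂
              (WeakValues.singlePhoton a) h₁ ∧
          ∀ α : ℂ, 0 < ‖α‖ ^ 2 →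
            ∃ hα : U₁ (WeakValues.coherentInput a α) ∈ (WeakValues.numberOp b).domain,
              WeakValues.weakValue (WeakValues.photonCountEffect c 1) (WeakValues.numberOp b)
                  U₁ U₂ (WeakValues.singlePhoton a) h₁ =
                (WeakValues.weakValue (WeakValues.clickEffect c) (WeakValues.numberOp b) U₁ U₂
                    (WeakValues.coherentInput a α) hα -
                  WeakValues.weakValue (WeakValues.noClickEffect c) (WeakValues.numberOp b) U₁ U₂
                    (WeakValues.coherentInput a α) hα) *
                (WeakValues.scaling (-(1 - Real.exp (-(T * ‖α‖ ^ 2)))) : ℂ) ∧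
              0 ≤ WeakValues.scaling (-(1 - Real.exp (-(T * ‖α‖ ^ 2)))) ∧
              WeakValues.scaling (-(1 - Real.exp (-(T * ‖α‖ ^ 2)))) ≤ 1) := by
  open WeakValues in
  obtain ⟨V₁, hV₁⟩ := hU₁.exists_map_expState
  obtain ⟨V₂, hV₂⟩ := hU₂.exists_map_expState
  set u := V₁ (EuclideanSpace.single a 1) with hu
  set v := V₂ u with hv
  set w := V₂ (EuclideanSpace.single b 1) with hw
  have hvn : ‖v‖ = 1 := by rw [hv, hu, V₂.norm_map, V₁.norm_map]; simp
  have hU₁α (α : ℂ) : U₁ (expState (α • EuclideanSpace.single a 1)) = expState (α • u) := by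
    rw [hV₁, map_smul]
  have hcoh (α : ℂ) : U₂ (U₁ (coherentInput a α)) =
      (Real.exp (-‖α‖ ^ 2 / 2) : ℂ) • expState (α • v) := by
    rw [coherentInput_eq, map_smul, map_smul, hU₁α, hV₂, map_smul]
  have hcoh' (α : ℂ) : U₂ (U₁ (coherentInput a α)) = coherentState (α • v).ofLp := by
    rw [hcoh, coherentState_eq_smul_expState, norm_smul, hvn, mul_one]
  have hs₁ : U₁ (singlePhoton a) = onePhoton u := by rw [← onePhoton_single, map_onePhoton hV₁]
  have hs₂ : U₂ (U₁ (singlePhoton a)) = onePhoton v := by rw [hs₁, map_onePhoton hV₂]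
  have hsq (z : ℂ) : z * (starRingEnd ℂ) z = ((‖z‖ ^ 2 : ℝ) : ℂ) := by
    rw [Complex.mul_conj']; push_cast; rfl
  refine ⟨‖v c‖ ^ 2, sq_nonneg _, ?_, ?_, ?_, ?_, ?_⟩
  · rw [sq_le_one_iff₀ (norm_nonneg _), ← hvn]
    exact PiLp.norm_apply_le v c
  · intro α γ hγ
    rw [hcoh'] at hγ
    rw [← coherentState_injective hγ, PiLp.smul_apply, smul_eq_mul, norm_mul, mul_pow, mul_comm]
  · intro α
    have h1 : inner ℂ (U₂ (U₁ (coherentInput a α))) (U₂ (U₁ (coherentInput a α))) = (1 : ℂ) := by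
      rw [hcoh, inner_smul_left, inner_smul_right, inner_expState, inner_self_eq_norm_sq_to_K,
        norm_smul, hvn, mul_one, Complex.conj_ofReal, ← mul_assoc, ← Complex.ofReal_mul,
        ← Real.exp_add, Complex.ofReal_exp, RCLike.ofReal_eq_complex_ofReal, ← Complex.exp_add,
        ← Complex.exp_zero]
      congr 1
      push_cast
      ring
    rw [resultProb, inner_clickEffect_right, h1, hcoh, map_smul, noClickEffect_expState,
      inner_smul_left, inner_smul_right, inner_expState, inner_emptyMode_left, norm_smul, hvn,
      mul_one, Complex.conj_ofReal, PiLp.smul_apply, smul_eq_mul, norm_mul, ← Complex.ofReal_exp,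
      ← Complex.ofReal_mul, ← Complex.ofReal_mul, ← Real.exp_add, ← Real.exp_add, Complex.sub_re,
      Complex.one_re, Complex.ofReal_re]
    ring_nf
  · rw [resultProb, hs₂, clickEffect_onePhoton, inner_smul_right, inner_onePhoton_singlePhoton, hsq,
      Complex.ofReal_re]
  intro hT
  have hvc : v c ≠ 0 := fun h => by simp [h] at hT
  have hd₁ := onePhoton_mem_numberOp_domain b u
  have h₁ : U₁ (singlePhoton a) ∈ (numberOp b).domain := hs₁ ▸ hd₁
  have hn : U₂ (numberOp b ⟨onePhoton u, hd₁⟩) = u b • onePhoton w := by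
    rw [numberOp_onePhoton, map_smul, ← onePhoton_single, map_onePhoton hV₂]
  have hw₁ : weakValue (photonCountEffect c 1) (numberOp b) U₁ U₂ (singlePhoton a) h₁ =
      (starRingEnd ℂ) (v c) * w c * u b / ((‖v c‖ ^ 2 : ℝ) : ℂ) := by
    rw [weakValue_eq _ _ _ _ hs₁ h₁ hd₁, hn, map_onePhoton hV₂, map_smul,
      photonCountEffect_one_onePhoton, photonCountEffect_one_onePhoton, inner_smul_right,
      inner_smul_right, inner_smul_right, inner_onePhoton_singlePhoton, hsq]
    ring
  refine ⟨h₁, ?_, fun α hα => ?_⟩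
  · rw [weakValue_eq _ _ _ _ hs₁ h₁ hd₁, weakValue_eq _ _ _ _ hs₁ h₁ hd₁, hn, map_onePhoton hV₂]
    simp only [map_smul, photonCountEffect_one_onePhoton, clickEffect_onePhoton]
  have hα0 : α ≠ 0 := fun h => by simp [h] at hα
  have hmem : U₁ (expState (α • EuclideanSpace.single a 1)) ∈ (numberOp b).domain :=
    hU₁α α ▸ expState_mem_numberOp_domain b _
  have hmem' : U₁ (coherentInput a α) ∈ (numberOp b).domain := by
    rw [coherentInput_eq, map_smul]
    exact Submodule.smul_mem _ _ hmem
  have hk : (Real.exp (-‖α‖ ^ 2 / 2) : ℂ) ≠ 0 := by exact_mod_cast (Real.exp_pos _).ne'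
  have hVc : V₂ (α • u) c = α * v c := by rw [map_smul]; rfl
  have hA : 0 < ‖v c‖ ^ 2 * ‖α‖ ^ 2 := mul_pos hT hα
  -- The logarithm undoes the exponential: `log (1 - p) = -T|α|²`.
  have hscal : scaling (-(1 - Real.exp (-(‖v c‖ ^ 2 * ‖α‖ ^ 2)))) =
      (1 - Real.exp (-(‖v c‖ ^ 2 * ‖α‖ ^ 2))) / (‖v c‖ ^ 2 * ‖α‖ ^ 2) := by
    rw [scaling, neg_sub, add_sub_cancel, Real.log_exp, div_neg, ← neg_div, neg_sub]
  have hp : 0 < 1 - Real.exp (-(‖v c‖ ^ 2 * ‖α‖ ^ 2)) :=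
    sub_pos.2 (Real.exp_lt_one_iff.2 (neg_lt_zero.2 hA))
  refine ⟨hmem', ?_, ?_, ?_⟩
  -- The coherent normalization drops out, so the difference formula for exponential vectors applies
  -- with `β = α u`.
  · rw [weakValue_smul _ _ _ _ hk (coherentInput_eq a α) hmem,
      weakValue_smul _ _ _ _ hk (coherentInput_eq a α) hmem,
      weakValue_click_sub_weakValue_noClick b c hV₂ (hU₁α α) hmem
        (by rw [hVc]; exact mul_ne_zero hα0 hvc), hVc, ← hw, hscal, hw₁]
    have he : -‖α * v c‖ ^ 2 = -(‖v c‖ ^ 2 * ‖α‖ ^ 2) := by rw [norm_mul]; ring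
    rw [he, PiLp.smul_apply, smul_eq_mul, map_mul, Complex.ofReal_div]
    generalize 1 - Real.exp (-(‖v c‖ ^ 2 * ‖α‖ ^ 2)) = p at hp
    have hp' : (p : ℂ) ≠ 0 := by exact_mod_cast hp.ne'
    have hα' : (starRingEnd ℂ) α ≠ 0 := by simpa using hα0
    have hT' : ((‖v c‖ ^ 2 : ℝ) : ℂ) ≠ 0 := by exact_mod_cast hT.ne'
    rw [Complex.ofReal_mul, ← hsq α]
    field_simp
  · rw [hscal]
    positivity
  · rw [hscal, div_le_one hA]
    -- The bound is `1 - exp (-A) ≤ A` with `A = T|α|²`.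
    linarith [Real.add_one_le_exp (-(‖v c‖ ^ 2 * ‖α‖ ^ 2))]
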